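/- Let $\binom{m}{r}$ denote the binomial coefficient for integers $m\ge 0$ and $r$, with $\binom{m}{r}=0$ if $r<0$ or $r>m$. For all integers $n\ge 1$ and $k\ge 0$, $$\det_{0\le i,j\le n-1}\left(\sum_{l=0}^{k}\binom{i+j}{\lfloor (i+j+1-k)/2\rfloor+l}\right)=\begin{cases}(-1)^{n_1\binom{k+1}{2}}&\text{if } n=(k+1)n_1 \text{ for an integer } n_1,\\(-1)^{n_1\binom{k+1}{2}}&\text{if } n=(k+1)n_1+1 \text{ for an integer } n_1,\\0&\text{if } n\not\equiv 0,1 \pmod{k+1}.\end{cases}$$ (For $k=0$ the first two cases both apply and both give $1$.) In particular, for $k=0$, $$\det_{0\le i,j\le n-1}\binom{i+j}{\lfloor (i+j+1)/2\rfloor}=\det_{0\le i,j\le n-1}\binom{i+j}{\lfloor (i+j)/2\rfloor}=1\qquad\text{for all } n\ge 1,$$ that is, all Hankel determinants of the sequence $\binom{m}{\lfloor m/2\rfloor}$, $m\ge 0$, equal $1$. -/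

import Mathlib

/-- The binomial coefficient `n.choose m` for a natural number `n` and an arbitrary integer `m`,
with the usual convention that it is `0` for `m < 0` (and for `m > n`). -/
def binomInt (n : ℕ) (m : ℤ) : ℤ :=
  if 0 ≤ m then (n.choose m.toNat : ℤ) else 0

/-- The entry `∑_{l=0}^k binom(m, ⌊(m+1-k)/2⌋ + l)`. Division of integers by `2` rounds down, so
`((m : ℤ) + 1 - k) / 2` is the floor of the rational number, also when `m + 1 - k` is negative. -/
def centralSum (k m : ℕ) : ℤ :=
  ∑ l ∈ Finset.range (k + 1), binomInt m (((m : ℤ) + 1 - (k : ℤ)) / 2 + (l : ℤ))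

/-- The `n × n` Hankel determinant `det_{0 ≤ i,j ≤ n-1} (a (i+j))`. -/
def hankelDet (n : ℕ) (a : ℕ → ℤ) : ℤ :=
  (Matrix.of fun i j : Fin n => a ((i : ℕ) + (j : ℕ))).det

/-! The entries are the moments of `centralFunctional k`, written L_k: the sum of the coefficients
of p(z + z⁻¹) at the exponents -k, …, k + 1. A Hankel determinant is the Gram determinant of any
monic polynomials of degrees 0, …, n - 1, so polynomials with a sparse Gram matrix are sought.

Let C be the Chebyshev polynomial with C(z + z⁻¹) = z^(k+1) + z^(-k-1). The 2(k + 1) exponents meet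
each residue class mod k + 1 exactly twice, whence L_k(F(C) q) = L_0(F) q(2) for deg q ≤ k
(`centralFunctional_comp_mul`). So L_k kills F(C) (X - 2)^r for 1 ≤ r ≤ k, while for r = k + 1 a
factor C - 2 survives.

For the polynomials S_a(C) (X - 2)^r, with S_a - S_(a-1) replacing S_a when r = 0, orthogonality
under L_0 gives Gram entries δ_ab at r = s = 0, zero for 1 ≤ r + s ≤ k, and -δ_ab for r + s = k + 1.
This determines the determinant for complete blocks (`det_of_antitriangular`). One further row is
zero off the diagonal; a longer incomplete block contains a zero row. -/

open LaurentPolynomial in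
/-- The Laurent polynomial `z + z⁻¹`. -/
noncomputable def joukowski : ℤ[T;T⁻¹] := T 1 + T (-1)

open LaurentPolynomial in
/-- The coefficient of `z ^ e` in a Laurent polynomial, as a linear map. -/
noncomputable def laurentCoeff (e : ℤ) : ℤ[T;T⁻¹] →ₗ[ℤ] ℤ where
  toFun g := g.coeff e
  map_add' _ _ := rfl
  map_smul' _ _ := rfl

/-! ### Coefficients of polynomials in z + z⁻¹ -/

section Laurent
open LaurentPolynomial

lemma laurentCoeff_mul_T (e j : ℤ) (g : ℤ[T;T⁻¹]) :
    laurentCoeff e (g * T j) = laurentCoeff (e - j) g := by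
  change (g * AddMonoidAlgebra.single j 1).coeff e = g.coeff (e - j)
  rw [AddMonoidAlgebra.coeff_mul_single_apply, mul_one, sub_eq_add_neg]

lemma laurentCoeff_T (e j : ℤ) : laurentCoeff e (T j) = if j = e then 1 else 0 :=
  T_apply e j

lemma laurentCoeff_invert (e : ℤ) (g : ℤ[T;T⁻¹]) :
    laurentCoeff e (invert g) = laurentCoeff (-e) g := invert_apply g e

lemma invert_aeval_joukowski (F : Polynomial ℤ) :
    invert (Polynomial.aeval joukowski F) = Polynomial.aeval joukowski F := by
  rw [← AlgEquiv.coe_toAlgHom, ← Polynomial.aeval_algHom_apply]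
  congr 2
  simp [joukowski, add_comm]

lemma laurentCoeff_neg_aeval_joukowski (e : ℤ) (F : Polynomial ℤ) :
    laurentCoeff (-e) (Polynomial.aeval joukowski F) =
      laurentCoeff e (Polynomial.aeval joukowski F) := by
  rw [← laurentCoeff_invert, invert_aeval_joukowski]

/-- The substitution `z ↦ z ^ d`. -/
noncomputable def laurentDilate (d : ℤ) : ℤ[T;T⁻¹] →ₐ[ℤ] ℤ[T;T⁻¹] :=
  AddMonoidAlgebra.mapDomainAlgHom ℤ ℤ (AddMonoidHom.mulLeft d)

lemma laurentDilate_T (d e : ℤ) : laurentDilate d (T e) = T (d * e) := by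
  simp [laurentDilate, T, -single_eq_C_mul_T]

lemma laurentCoeff_mul_laurentDilate {d : ℤ} (hd : d ≠ 0) (e : ℤ) (g : ℤ[T;T⁻¹]) :
    laurentCoeff (d * e) (laurentDilate d g) = laurentCoeff e g := by
  induction g using LaurentPolynomial.induction_on' with
  | add p q hp hq => simp only [map_add, hp, hq]
  | C_mul_T n a =>
    rw [← smul_eq_C_mul, map_smul, map_smul, map_smul, laurentDilate_T, laurentCoeff_T,
      laurentCoeff_T]
    simp [hd]

lemma laurentCoeff_laurentDilate_of_not_dvd {d e : ℤ} (h : ¬ d ∣ e) (g : ℤ[T;T⁻¹]) :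
    laurentCoeff e (laurentDilate d g) = 0 := by
  induction g using LaurentPolynomial.induction_on' with
  | add p q hp hq => simp only [map_add, hp, hq, add_zero]
  | C_mul_T n a =>
    rw [← smul_eq_C_mul, map_smul, map_smul, laurentDilate_T, laurentCoeff_T,
      if_neg (fun h' => h ⟨n, h'.symm⟩), smul_zero]

lemma binomInt_succ (m : ℕ) (j : ℤ) :
    binomInt (m + 1) j = binomInt m (j - 1) + binomInt m j := by
  unfold binomInt
  rcases lt_trichotomy j 0 with h | rfl | h
  · rw [if_neg (by lia), if_neg (by lia), if_neg (by lia)]; rfl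
  · simp
  · lift j to ℕ using h.le
    obtain ⟨i, rfl⟩ : ∃ i, j = i + 1 := ⟨j - 1, by lia⟩
    rw [if_pos (by lia), if_pos (by lia), if_pos (by lia)]
    simp [Nat.choose_succ_succ]

lemma laurentCoeff_joukowski_pow (m : ℕ) (e : ℤ) :
    laurentCoeff e (joukowski ^ m) = if 2 ∣ m + e then binomInt m ((m + e) / 2) else 0 := by
  induction m generalizing e with
  | zero =>
    rw [pow_zero, ← T_zero, laurentCoeff_T]
    unfold binomInt
    rcases lt_trichotomy e 0 with h | rfl | h
    · rw [if_neg (by lia)]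
      split_ifs <;> first | rfl | lia
    · simp
    · rw [if_neg (by lia)]
      split_ifs with h2 h3
      · obtain ⟨i, hi⟩ : ∃ i, (((0 : ℕ) + e) / 2).toNat = i + 1 :=
          ⟨(((0 : ℕ) + e) / 2).toNat - 1, by lia⟩
        rw [hi]; simp
      · rfl
      · rfl
  | succ m ih =>
    rw [pow_succ]
    nth_rw 2 [joukowski]
    rw [mul_add, map_add, laurentCoeff_mul_T, laurentCoeff_mul_T, ih, ih]
    by_cases h : (2 : ℤ) ∣ (m + 1 : ℕ) + e
    · rw [if_pos (by lia), if_pos (by lia), if_pos h, binomInt_succ]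
      congr 2 <;> lia
    · rw [if_neg (by lia), if_neg (by lia), if_neg h, add_zero]

/-- The functional on polynomials with moments `centralSum k`: the constant term of
`p (z + z⁻¹) * (z ^ (-k-1) + ⋯ + z ^ k)`. -/
noncomputable def centralFunctional (k : ℕ) : Polynomial ℤ →ₗ[ℤ] ℤ :=
  laurentCoeff 0 ∘ₗ LinearMap.mulRight ℤ (∑ e ∈ Finset.range (2 * (k + 1)), T ((k : ℤ) - e)) ∘ₗ
    (Polynomial.aeval joukowski).toLinearMap

lemma centralFunctional_apply (k : ℕ) (p : Polynomial ℤ) :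
    centralFunctional k p = ∑ e ∈ Finset.range (2 * (k + 1)),
      laurentCoeff ((e : ℤ) - k) (Polynomial.aeval joukowski p) := by
  simp [centralFunctional, Finset.mul_sum, laurentCoeff_mul_T]

lemma centralFunctional_X_pow (k m : ℕ) :
    centralFunctional k (Polynomial.X ^ m) = centralSum k m := by
  rw [centralFunctional_apply, centralSum]
  simp only [map_pow, Polynomial.aeval_X, laurentCoeff_joukowski_pow]
  generalize k + 1 = n
  induction n with
  | zero => simp
  | succ n ih =>
    rw [mul_add, Finset.sum_range_succ, Finset.sum_range_succ, ih, Finset.sum_range_succ, add_assoc]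
    congr 1
    -- Exactly one of the consecutive exponents 2n - k and 2n + 1 - k has the parity of m; either
    -- way it yields the binomial with l = n.
    by_cases h : (2 : ℤ) ∣ (m : ℤ) + ((2 * n : ℕ) - k)
    · rw [if_pos h, if_neg (by lia), add_zero]
      congr 1; lia
    · rw [if_neg h, if_pos (by lia), zero_add]
      congr 1; lia

/-! ### Composition with Chebyshev polynomials -/

lemma centralFunctional_zero_apply (F : Polynomial ℤ) :
    centralFunctional 0 F = laurentCoeff 0 (Polynomial.aeval joukowski F) +
      laurentCoeff 1 (Polynomial.aeval joukowski F) := by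
  simp [centralFunctional_apply, Finset.sum_range_succ]

lemma aeval_joukowski_chebyshevC (n : ℕ) :
    Polynomial.aeval joukowski (Polynomial.Chebyshev.C ℤ n) = T n + T (-n) := by
  induction n using Nat.twoStepInduction with
  | zero => simpa [one_add_one_eq_two] using map_ofNat (Polynomial.aeval joukowski) 2
  | one => simp [joukowski]
  | more n h0 h1 =>
    push_cast at h1 ⊢
    rw [Polynomial.Chebyshev.C_add_two, map_sub, map_mul, h0, h1, Polynomial.aeval_X, joukowski]
    simp only [add_mul, mul_add, ← T_add]
    ring_nf

lemma aeval_joukowski_comp_chebyshevC (n : ℕ) (F : Polynomial ℤ) :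
    Polynomial.aeval joukowski (F.comp (Polynomial.Chebyshev.C ℤ n)) =
      laurentDilate n (Polynomial.aeval joukowski F) := by
  rw [Polynomial.aeval_comp, aeval_joukowski_chebyshevC, ← Polynomial.aeval_algHom_apply]
  simp [joukowski, laurentDilate_T]

/-- Only exponents congruent to r mod k + 1 contribute, and the window -k, …, k + 1 contains exactly
two: r and one neighbour r ± (k + 1). Symmetry under z ↦ z⁻¹ makes the choice of neighbour
immaterial. -/
lemma sum_laurentCoeff_laurentDilate (k : ℕ) (F : Polynomial ℤ) (r : ℤ) (hr : |r| ≤ k) :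
    ∑ e ∈ Finset.range (2 * (k + 1)),
      laurentCoeff ((e : ℤ) - k) (laurentDilate (k + 1 : ℕ) (Polynomial.aeval joukowski F) * T r) =
    centralFunctional 0 F := by
  have hk : ((k + 1 : ℕ) : ℤ) ≠ 0 := by lia
  rw [abs_le] at hr
  have key : ∀ s : ℤ, (s = 1 ∨ s = -1) → 0 ≤ r + k + s * (k + 1) →
      r + k + s * (k + 1) < 2 * (k + 1) →
    ∑ e ∈ Finset.range (2 * (k + 1)),
      laurentCoeff ((e : ℤ) - k) (laurentDilate (k + 1 : ℕ) (Polynomial.aeval joukowski F) * T r) =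
    centralFunctional 0 F := by
    intro s hs h0 h1
    simp only [laurentCoeff_mul_T]
    rw [Finset.sum_eq_add (r + k).toNat (r + k + s * (k + 1)).toNat]
    · rw [centralFunctional_zero_apply]
      congr 1
      · rw [← laurentCoeff_mul_laurentDilate hk 0,
          show ((k + 1 : ℕ) : ℤ) * 0 = ((r + k).toNat : ℤ) - k - r by lia]
      · rcases hs with rfl | rfl
        · rw [← laurentCoeff_mul_laurentDilate hk 1, show ((k + 1 : ℕ) : ℤ) * 1 =
            ((r + k + 1 * (k + 1)).toNat : ℤ) - k - r by lia]
        · rw [← laurentCoeff_neg_aeval_joukowski,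
            ← laurentCoeff_mul_laurentDilate hk (-1),
            show ((k + 1 : ℕ) : ℤ) * -1 =
              ((r + k + -1 * (k + 1)).toNat : ℤ) - k - r by lia]
    · rcases hs with rfl | rfl <;> lia
    · intro e he hne
      apply laurentCoeff_laurentDilate_of_not_dvd
      rintro ⟨c, hc⟩
      rw [Finset.mem_range] at he
      have hc1 : c < 2 := by
        by_contra hcc
        have : ((k + 1 : ℕ) : ℤ) * 2 ≤ (k + 1 : ℕ) * c := by gcongr; lia
        lia
      have hc2 : -2 < c := by
        by_contra hcc
        have : ((k + 1 : ℕ) : ℤ) * c ≤ (k + 1 : ℕ) * (-2) := by gcongr; lia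
        lia
      rcases hs with rfl | rfl <;> interval_cases c <;> lia
    · intro h
      exact absurd (Finset.mem_range.2 (by lia)) h
    · intro h
      exact absurd (Finset.mem_range.2 (by rcases hs with rfl | rfl <;> lia)) h
  -- The neighbour r + k + 1 lies in the window only for r ≤ 0; for r ≥ 1 it is r - k - 1.
  by_cases h : 1 ≤ r
  · exact key (-1) (Or.inr rfl) (by lia) (by lia)
  · exact key 1 (Or.inl rfl) (by lia) (by lia)

/-- Each factor z + z⁻¹ splits the sum into those for r + 1 and r - 1, which are equal while the
shifts stay within [-k, k]. -/
lemma sum_laurentCoeff_laurentDilate_mul_pow (k m : ℕ) (F : Polynomial ℤ) (r : ℤ)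
    (hr : |r| + m ≤ k) :
    ∑ e ∈ Finset.range (2 * (k + 1)), laurentCoeff ((e : ℤ) - k)
      (laurentDilate (k + 1 : ℕ) (Polynomial.aeval joukowski F) * joukowski ^ m * T r) =
    2 ^ m * centralFunctional 0 F := by
  induction m generalizing r with
  | zero => simpa using sum_laurentCoeff_laurentDilate k F r (by simpa using hr)
  | succ m ih =>
    have h1 := ih (r + 1) (by rw [abs_eq_max_neg] at *; lia)
    have h2 := ih (r - 1) (by rw [abs_eq_max_neg] at *; lia)
    rw [pow_succ (2 : ℤ), mul_right_comm (2 ^ m : ℤ), mul_two]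
    nth_rw 1 [← h1]
    rw [← h2, ← Finset.sum_add_distrib]
    refine Finset.sum_congr rfl fun e _ => ?_
    rw [← map_add, ← mul_add, mul_assoc, mul_assoc, pow_succ, mul_assoc]
    have : joukowski * T r = T (r + 1) + T (r - 1) := by
      rw [joukowski, add_mul, ← T_add, ← T_add, add_comm 1 r, neg_add_eq_sub]
    rw [this]

/-- On products `F (C_{k+1}) * q` with `deg q ≤ k` the functional factors. -/
lemma centralFunctional_comp_mul (k : ℕ) (F q : Polynomial ℤ) (hq : q.natDegree ≤ k) :
    centralFunctional k (F.comp (Polynomial.Chebyshev.C ℤ (k + 1 : ℕ)) * q) =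
      centralFunctional 0 F * q.eval 2 := by
  rw [q.as_sum_range' (k + 1) (by lia), Finset.mul_sum, map_sum, Polynomial.eval_finsetSum,
    Finset.mul_sum]
  refine Finset.sum_congr rfl fun m hm => ?_
  rw [← mul_one (q.coeff m), ← smul_eq_mul (q.coeff m) 1, ← Polynomial.smul_monomial, mul_smul_comm, map_smul,
    centralFunctional_apply, Polynomial.monomial_one_right_eq_X_pow]
  have := sum_laurentCoeff_laurentDilate_mul_pow k m F 0
    (by rw [Finset.mem_range] at hm; simp; lia)
  simp only [map_mul, aeval_joukowski_comp_chebyshevC, map_pow, Polynomial.aeval_X]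
  simp only [T_zero, mul_one] at this
  rw [this]
  simp
  ring

end Laurent

/-! ### Orthogonality of Chebyshev polynomials and the adapted basis -/

section Orthogonality
open Polynomial Polynomial.Chebyshev
open LaurentPolynomial (T T_add T_zero)

/-- Symmetry trades the exponent 1 for -1, producing the weight `1 + T 1`, which collapses `S n - S
(n - 1)` to two terms. -/
lemma centralFunctional_zero_apply' (F : ℤ[X]) :
    centralFunctional 0 F = laurentCoeff 0 (aeval joukowski F * (1 + T 1)) := by
  rw [centralFunctional_zero_apply, mul_add, mul_one, map_add, laurentCoeff_mul_T, zero_sub,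
    laurentCoeff_neg_aeval_joukowski]

lemma aeval_joukowski_chebyshevS_mul (n : ℕ) :
    aeval joukowski (S ℤ n) * (T 1 - T (-1)) = T (n + 1) - T (-(n + 1)) := by
  induction n using Nat.twoStepInduction with
  | zero => simp
  | one =>
    simp only [Nat.cast_one, S_one, aeval_X, joukowski]
    simp only [add_mul, mul_sub, ← T_add]
    ring_nf
  | more n h0 h1 =>
    push_cast at h1 ⊢
    rw [S_add_two, map_sub, map_mul, sub_mul, mul_assoc, h0, h1, aeval_X, joukowski]
    simp only [add_mul, mul_sub, ← T_add]
    ring_nf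

lemma aeval_joukowski_chebyshevS_sub_mul (n : ℕ) :
    aeval joukowski (S ℤ n - S ℤ (n - 1)) * (1 + T 1) = T (n + 1) + T (-n) := by
  induction n using Nat.twoStepInduction with
  | zero => simp [add_comm]
  | one =>
    simp only [Nat.cast_one, S_one, sub_self, S_zero, map_sub, map_one, aeval_X, joukowski]
    simp only [add_mul, mul_add, sub_mul, mul_one, one_mul, ← T_add]
    norm_num
    abel
  | more n h0 h1 =>
    have h : S ℤ (n + 2 : ℕ) - S ℤ ((n + 2 : ℕ) - 1) =
        X * (S ℤ (n + 1 : ℕ) - S ℤ ((n + 1 : ℕ) - 1)) - (S ℤ n - S ℤ (n - 1)) := by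
      have h2 := S_add_two ℤ (n : ℤ)
      have h3 := S_add_one ℤ (n : ℤ)
      push_cast
      rw [show (n : ℤ) + 2 - 1 = n + 1 by ring, show (n : ℤ) + 1 - 1 = n by ring, h2]
      linear_combination -h3
    rw [h, map_sub, map_mul, sub_mul, mul_assoc, h0, h1, aeval_X, joukowski]
    push_cast
    simp only [add_mul, mul_add, ← T_add]
    ring_nf

/-- The first factor absorbs `1 + T 1` and becomes `T (a + 1) + T (-a)`. As the second factor is
symmetric, the constant term is then the coefficient at -a of that factor times `1 + T 1`, which
also has just two terms. -/
lemma centralFunctional_zero_chebyshevS_sub_mul (a b : ℕ) :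
    centralFunctional 0 ((S ℤ a - S ℤ (a - 1)) * (S ℤ b - S ℤ (b - 1))) =
      if a = b then 1 else 0 := by
  have hb : laurentCoeff (-a) (aeval joukowski (S ℤ b - S ℤ (b - 1)) * (1 + T 1)) =
      if a = b then 1 else 0 := by
    rw [aeval_joukowski_chebyshevS_sub_mul, map_add, laurentCoeff_T, laurentCoeff_T,
      if_neg (by lia), zero_add]
    exact if_congr (by lia) rfl rfl
  rw [← hb, centralFunctional_zero_apply', mul_comm (S ℤ a - _), map_mul (aeval _), mul_assoc,
    aeval_joukowski_chebyshevS_sub_mul, mul_add, mul_add, map_add, map_add, mul_one]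
  simp only [laurentCoeff_mul_T]
  rw [zero_sub, zero_sub, neg_neg, laurentCoeff_neg_aeval_joukowski,
    laurentCoeff_neg_aeval_joukowski, ← laurentCoeff_neg_aeval_joukowski, add_comm]
  ring_nf

lemma centralFunctional_zero_chebyshevS_mul (a b : ℕ) :
    centralFunctional 0 (S ℤ a * S ℤ b * (X - 2)) = if a = b then -1 else 0 := by
  have hb : laurentCoeff (-(a + 1)) (aeval joukowski (S ℤ b) * (T 1 - T (-1))) =
      if a = b then -1 else 0 := by
    rw [aeval_joukowski_chebyshevS_mul, map_sub, laurentCoeff_T, laurentCoeff_T,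
      if_neg (by lia), zero_sub, apply_ite Neg.neg, neg_zero]
    exact if_congr (by lia) rfl rfl
  -- This supplies the factor `T 1 - T (-1)` that collapses `S a`; symmetry of the other factor then
  -- cancels two of the four resulting terms.
  have h : aeval joukowski (X - 2 : ℤ[X]) * (1 + T 1) = (T 1 - T (-1)) * (T 1 - 1) := by
    rw [map_sub, aeval_X, map_ofNat, joukowski]
    simp only [add_mul, mul_add, sub_mul, mul_sub, mul_one, ← T_add]
    norm_num
    ring
  rw [← hb, centralFunctional_zero_apply', mul_comm (S ℤ a), map_mul (aeval _), map_mul (aeval _), mul_assoc, h,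
    mul_assoc, ← mul_assoc (aeval _ _) _ (T 1 - 1), aeval_joukowski_chebyshevS_mul]
  simp only [mul_sub, sub_mul, ← T_add, map_sub, mul_one, laurentCoeff_mul_T]
  have h1 := laurentCoeff_neg_aeval_joukowski (a + 1) (S ℤ b)
  have h2 := laurentCoeff_neg_aeval_joukowski a (S ℤ b)
  ring_nf at h1 h2 ⊢
  rw [h1, h2]
  ring

lemma degree_chebyshevS (n : ℕ) : (S ℤ n).degree = n ∧ (S ℤ n).Monic := by
  induction n using Nat.twoStepInduction with
  | zero => simp
  | one => simp
  | more n h0 h1 =>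
    have hX : (X * S ℤ (n + 1 : ℕ)).degree = ((n + 2 : ℕ) : WithBot ℕ) := by
      rw [degree_mul, h1.1, degree_X]; norm_cast; lia
    have hlt : (S ℤ n).degree < (X * S ℤ (n + 1 : ℕ)).degree := by
      rw [hX, h0.1]; norm_cast; lia
    have h : S ℤ (n + 2 : ℕ) = X * S ℤ (n + 1 : ℕ) - S ℤ n := by
      push_cast; exact S_add_two ℤ n
    rw [h]
    exact ⟨by rw [degree_sub_eq_left_of_degree_lt hlt, hX],
      (monic_X.mul h1.2).sub_of_left hlt⟩

lemma degree_chebyshevS_sub_one_lt (n : ℕ) : (S ℤ (n - 1)).degree < n := by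
  cases n with
  | zero => simp
  | succ n =>
    rw [Nat.cast_succ, add_sub_cancel_right, (degree_chebyshevS n).1]
    norm_cast; lia

lemma degree_chebyshevS_sub (n : ℕ) :
    (S ℤ n - S ℤ (n - 1)).degree = n ∧ (S ℤ n - S ℤ (n - 1)).Monic := by
  obtain ⟨h1, h2⟩ := degree_chebyshevS n
  have h : (S ℤ (n - 1)).degree < (S ℤ n).degree := h1 ▸ degree_chebyshevS_sub_one_lt n
  exact ⟨by rw [degree_sub_eq_left_of_degree_lt h, h1], h2.sub_of_left h⟩

lemma degree_chebyshevC_succ (k : ℕ) :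
    (C ℤ (k + 1 : ℕ)).degree = (k + 1 : ℕ) ∧ (C ℤ (k + 1 : ℕ)).Monic := by
  obtain ⟨h1, h2⟩ := degree_chebyshevS (k + 1)
  have hC : C ℤ (k + 1 : ℕ) = S ℤ (k + 1 : ℕ) - S ℤ (k - 1) := by
    rw [C_eq_S_sub_X_mul_S]
    push_cast
    rw [add_sub_cancel_right, S_add_one]
    ring
  have h : (S ℤ (k - 1)).degree < (S ℤ (k + 1 : ℕ)).degree := by
    rw [h1]
    exact (degree_chebyshevS_sub_one_lt k).trans (by norm_cast; lia)
  rw [hC]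
  exact ⟨by rw [degree_sub_eq_left_of_degree_lt h, h1], h2.sub_of_left h⟩

/-- A monic polynomial of degree `a * (k + 1) + r`, where `r ≤ k`. -/
noncomputable def centralBasis (k a r : ℕ) : ℤ[X] :=
  if r = 0 then (S ℤ a - S ℤ (a - 1)).comp (C ℤ (k + 1 : ℕ))
  else (S ℤ a).comp (C ℤ (k + 1 : ℕ)) * (X - 2) ^ r

lemma centralBasis_monic (k a r : ℕ) : (centralBasis k a r).Monic := by
  have hC : (C ℤ (k + 1 : ℕ)).natDegree ≠ 0 := by
    rw [natDegree_eq_of_degree_eq_some (degree_chebyshevC_succ k).1]; lia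
  unfold centralBasis
  split_ifs
  · exact (degree_chebyshevS_sub a).2.comp (degree_chebyshevC_succ k).2 hC
  · exact ((degree_chebyshevS a).2.comp (degree_chebyshevC_succ k).2 hC).mul
      ((monic_X_sub_C (2 : ℤ)).pow r)

lemma natDegree_centralBasis (k a r : ℕ) :
    (centralBasis k a r).natDegree = r + (k + 1) * a := by
  have hC : (C ℤ (k + 1 : ℕ)).natDegree = k + 1 :=
    natDegree_eq_of_degree_eq_some (degree_chebyshevC_succ k).1
  have h2 : (X - 2 : ℤ[X]).natDegree = 1 := natDegree_X_sub_C (2 : ℤ)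
  unfold centralBasis
  split_ifs with h
  · rw [natDegree_comp, hC, natDegree_eq_of_degree_eq_some (degree_chebyshevS_sub a).1, h]
    ring
  · have hm : (X - 2 : ℤ[X]) ≠ 0 := X_sub_C_ne_zero (2 : ℤ)
    have h0 : (S ℤ a).comp (C ℤ (k + 1 : ℕ)) ≠ 0 :=
      ((degree_chebyshevS a).2.comp (degree_chebyshevC_succ k).2 (by lia)).ne_zero
    rw [natDegree_mul h0 (pow_ne_zero _ hm), natDegree_comp, hC, natDegree_pow, h2,
      natDegree_eq_of_degree_eq_some (degree_chebyshevS a).1]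
    ring

lemma centralFunctional_comp (k : ℕ) (F : ℤ[X]) :
    centralFunctional k (F.comp (C ℤ (k + 1 : ℕ))) = centralFunctional 0 F := by
  simpa using centralFunctional_comp_mul k F 1 (by simp)

lemma centralFunctional_comp_mul_pow_of_le (k m : ℕ) (hm0 : m ≠ 0) (hm : m ≤ k) (F : ℤ[X]) :
    centralFunctional k (F.comp (C ℤ (k + 1 : ℕ)) * (X - 2) ^ m) = 0 := by
  have h2 : (X - 2 : ℤ[X]).natDegree = 1 := natDegree_X_sub_C (2 : ℤ)
  rw [centralFunctional_comp_mul k F _ (by rw [natDegree_pow, h2]; lia)]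
  simp [hm0]

/-- Both (X - 2)^(k+1) and C are monic of degree k + 1, so (X - 2)^(k+1) = (C - 2) + q with deg q ≤
k. Since C(2) = 2, q(2) = 0 and only C - 2, the composite of X - 2 with C, contributes. -/
lemma centralFunctional_comp_mul_pow_succ (k : ℕ) (F : ℤ[X]) :
    centralFunctional k (F.comp (C ℤ (k + 1 : ℕ)) * (X - 2) ^ (k + 1)) =
      centralFunctional 0 (F * (X - 2)) := by
  obtain ⟨h1, h2⟩ := degree_chebyshevC_succ k
  have hp : ((X - 2 : ℤ[X]) ^ (k + 1)).degree = (k + 1 : ℕ) := by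
    rw [degree_pow, show (X - 2 : ℤ[X]).degree = 1 from degree_X_sub_C (2 : ℤ)]; simp
  have hpm : ((X - 2 : ℤ[X]) ^ (k + 1)).Monic := (monic_X_sub_C (2 : ℤ)).pow _
  have hlt : ((X - 2 : ℤ[X]) ^ (k + 1) - C ℤ (k + 1 : ℕ)).degree < (k + 1 : ℕ) := by
    rw [← hp]
    exact degree_sub_lt_left (hp.trans h1.symm) hpm.ne_zero
      (hpm.leadingCoeff.trans h2.leadingCoeff.symm)
  have hle : ((X - 2 : ℤ[X]) ^ (k + 1) - C ℤ (k + 1 : ℕ) + 2).natDegree ≤ k := by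
    refine (natDegree_add_le _ _).trans (max_le ?_ (by simp))
    exact natDegree_le_iff_coeff_eq_zero.2 fun N hN =>
      coeff_eq_zero_of_degree_lt (hlt.trans_le (by exact_mod_cast hN))
  have hsplit : F.comp (C ℤ (k + 1 : ℕ)) * (X - 2) ^ (k + 1) =
      (F * (X - 2)).comp (C ℤ (k + 1 : ℕ)) +
        F.comp (C ℤ (k + 1 : ℕ)) * ((X - 2) ^ (k + 1) - C ℤ (k + 1 : ℕ) + 2) := by
    simp only [mul_comp, sub_comp, X_comp, ofNat_comp]
    ring
  rw [hsplit, map_add, centralFunctional_comp, centralFunctional_comp_mul k F _ hle]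
  simp [C_eval_two]

lemma centralFunctional_centralBasis_mul_zero_zero (k a b : ℕ) :
    centralFunctional k (centralBasis k a 0 * centralBasis k b 0) = if a = b then 1 else 0 := by
  rw [centralBasis, centralBasis, if_pos rfl, if_pos rfl, ← mul_comp, centralFunctional_comp,
    centralFunctional_zero_chebyshevS_sub_mul]

lemma centralFunctional_centralBasis_mul_of_le (k a b r s : ℕ) (h0 : r + s ≠ 0) (h : r + s ≤ k) :
    centralFunctional k (centralBasis k a r * centralBasis k b s) = 0 := by
  unfold centralBasis
  split_ifs with hr hs hs
  · lia
  · rw [← mul_assoc, ← mul_comp, centralFunctional_comp_mul_pow_of_le _ _ hs (by lia)]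
  · rw [mul_right_comm, ← mul_comp, centralFunctional_comp_mul_pow_of_le _ _ hr (by lia)]
  · rw [mul_mul_mul_comm, ← mul_comp, ← pow_add,
      centralFunctional_comp_mul_pow_of_le _ _ h0 h]

lemma centralFunctional_centralBasis_mul_of_eq (k a b r s : ℕ) (hr : r ≠ 0) (hs : s ≠ 0)
    (h : r + s = k + 1) :
    centralFunctional k (centralBasis k a r * centralBasis k b s) = if a = b then -1 else 0 := by
  rw [centralBasis, centralBasis, if_neg hr, if_neg hs, mul_mul_mul_comm, ← mul_comp, ← pow_add,
    h, centralFunctional_comp_mul_pow_succ, centralFunctional_zero_chebyshevS_mul]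

end Orthogonality

/-! ### Gram determinants and their evaluation -/

section Determinants
open Polynomial Matrix

/-- A Hankel determinant equals the Gram determinant of any sequence of monic polynomials
of degrees `0, 1, …, n - 1`. -/
lemma hankelDet_eq_det_gram (L : ℤ[X] →ₗ[ℤ] ℤ) (a : ℕ → ℤ) (ha : ∀ m, L (X ^ m) = a m) (n : ℕ)
    (p : Fin n → ℤ[X]) (hdeg : ∀ i, (p i).natDegree = i) (hmonic : ∀ i, (p i).Monic) :
    hankelDet n a = (Matrix.of fun i j => L (p i * p j)).det := by
  have hA := Matrix.det_matrixOfPolynomials p hdeg hmonic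
  set A := Matrix.of fun i j : Fin n => (p j).coeff i with hAdef
  have hp : ∀ i, p i = ∑ u : Fin n, (p i).coeff u • X ^ (u : ℕ) := fun i => by
    rw [Fin.sum_univ_eq_sum_range (fun u => (p i).coeff u • (X : ℤ[X]) ^ u) n]
    conv_lhs => rw [(p i).as_sum_range' n (by rw [hdeg]; exact i.2)]
    simp [smul_X_eq_monomial]
  have hgram : (Matrix.of fun i j => L (p i * p j)) =
      Aᵀ * (Matrix.of fun i j : Fin n => a ((i : ℕ) + (j : ℕ))) * A := by
    ext i j
    rw [Matrix.of_apply]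
    conv_lhs => rw [hp i, hp j]
    simp only [Finset.sum_mul, Finset.mul_sum, map_sum, smul_mul_smul_comm, ← pow_add, map_smul, ha,
      Matrix.mul_apply, Matrix.transpose_apply, hAdef, Matrix.of_apply, smul_eq_mul]
    exact Finset.sum_congr rfl fun _ _ => Finset.sum_congr rfl fun _ _ => by ring
  rw [hgram, Matrix.det_mul, Matrix.det_mul, Matrix.det_transpose, hA, hankelDet]
  ring

lemma sign_neg_fin (k : ℕ) :
    Equiv.Perm.sign (Equiv.neg (Fin (k + 1))) = (-1) ^ k.choose 2 := by
  have h : ∀ i j : Fin (k + 1), i < j →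
      (if Equiv.neg (Fin (k + 1)) i < Equiv.neg (Fin (k + 1)) j then (1 : ℤˣ) else -1) =
        if i = 0 then 1 else -1 := by
    intro i j hij
    refine if_congr ?_ rfl rfl
    simp only [Equiv.neg_apply, Fin.lt_def, Fin.ext_iff, Fin.val_neg', Fin.val_zero] at *
    have hj := j.2
    rw [Nat.mod_eq_of_lt (a := k + 1 - (j : ℕ)) (by lia)]
    rcases Nat.eq_zero_or_pos (i : ℕ) with h0 | h0
    · simp [h0]; lia
    · rw [Nat.mod_eq_of_lt (by lia)]; lia
  rw [Equiv.Perm.sign_eq_prod_prod_Iio]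
  -- Negation fixes 0 and reverses the rest, so j is inverted with exactly the i in `Ioo 0 j`;
  -- truncated subtraction covers j = 0.
  have h' : ∀ j : Fin (k + 1),
      ∏ i ∈ Finset.Iio j, (if Equiv.neg (Fin (k + 1)) i < Equiv.neg (Fin (k + 1)) j then
        (1 : ℤˣ) else -1) = (-1) ^ ((j : ℕ) - 1) := by
    intro j
    rw [Finset.prod_congr rfl fun i hi => h i j (Finset.mem_Iio.1 hi), Finset.prod_ite,
      Finset.prod_const_one, one_mul, Finset.prod_const]
    congr 1
    rw [show {i ∈ Finset.Iio j | ¬ i = 0} = Finset.Ioo 0 j by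
      ext i; simp [Fin.pos_iff_ne_zero, and_comm]]
    simp
  rw [Finset.prod_congr rfl fun j _ => h' j,
    Fin.prod_univ_eq_prod_range (fun j => (-1 : ℤˣ) ^ (j - 1)) (k + 1), Finset.prod_pow_eq_pow_sum,
    Finset.sum_range_succ']
  simp [Finset.sum_range_id, Nat.choose_two_right]

/-- A matrix indexed by `Fin m × Fin (k + 1)` that is anti-triangular in the nonzero second
coordinates, up to the order of the blocks. -/
lemma det_of_antitriangular (m k : ℕ) (M : Matrix (Fin m × Fin (k + 1)) (Fin m × Fin (k + 1)) ℤ)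
    (h00 : ∀ a b, M (a, 0) (b, 0) = if a = b then 1 else 0)
    (hle : ∀ a b (r s : Fin (k + 1)), (r : ℕ) + s ≠ 0 → (r : ℕ) + s ≤ k → M (a, r) (b, s) = 0)
    (heq : ∀ a b (r s : Fin (k + 1)), (r : ℕ) + s = k + 1 →
      M (a, r) (b, s) = if a = b then -1 else 0) :
    M.det = (-1) ^ (m * (k + 1).choose 2) := by
  -- Negating the second coordinate of the columns moves the entries with r + s = k + 1 into the
  -- diagonal blocks.
  let σ : Equiv.Perm (Fin m × Fin (k + 1)) :=
    Equiv.prodCongrRight fun _ => Equiv.neg (Fin (k + 1))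
  have hσ : Equiv.Perm.sign σ = (-1) ^ (m * k.choose 2) := by
    rw [Equiv.Perm.sign_prodCongrRight, Finset.prod_const, sign_neg_fin, ← pow_mul, mul_comm]
    simp
  have hneg : ∀ t : Fin (k + 1), t ≠ 0 → ((-t : Fin (k + 1)) : ℕ) = k + 1 - t := fun t ht => by
    have : (t : ℕ) ≠ 0 := fun h => ht (Fin.ext h)
    rw [Fin.val_neg', Nat.mod_eq_of_lt (by lia)]
  have hdiag : ∀ a b (r : Fin (k + 1)), M (a, r) (b, -r) =
      if a = b then (if r = 0 then 1 else -1) else 0 := by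
    intro a b r
    split_ifs with hab hr
    · simp [hr, h00, hab]
    · rw [heq _ _ _ _ (by rw [hneg r hr]; lia), if_pos hab]
    · by_cases hr : r = 0
      · simp [hr, h00, hab]
      · rw [heq _ _ _ _ (by rw [hneg r hr]; lia), if_neg hab]
  have htri : (M.submatrix id σ)ᵀ.BlockTriangular (Prod.snd) := by
    rintro ⟨b, t⟩ ⟨a, r⟩ (hrt : r < t)
    have ht : t ≠ 0 := (Fin.zero_le r).trans_lt hrt |>.ne'
    have hσt : ((Equiv.neg (Fin (k + 1)) t : Fin (k + 1)) : ℕ) = k + 1 - t := hneg t ht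
    rw [Fin.lt_def] at hrt
    exact hle _ _ _ _ (by rw [hσt]; lia) (by rw [hσt]; lia)
  have hblock : ∀ r : Fin (k + 1), ((M.submatrix id σ)ᵀ.toSquareBlock Prod.snd r).det =
      (if r = 0 then 1 else -1) ^ m := by
    intro r
    have : (M.submatrix id σ)ᵀ.toSquareBlock Prod.snd r =
        Matrix.diagonal fun _ => if r = 0 then 1 else -1 := by
      ext ⟨⟨a, s⟩, rfl⟩ ⟨⟨b, t⟩, ht⟩
      obtain rfl : t = s := ht
      have := hdiag b a t
      simp only [Matrix.toSquareBlock_def, Matrix.of_apply, Matrix.diagonal_apply, Subtype.mk.injEq,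
        Prod.mk.injEq, and_true]
      rw [← if_congr (Iff.intro Eq.symm Eq.symm : b = a ↔ a = b) rfl rfl]
      exact this
    rw [this, Matrix.det_diagonal, Finset.prod_const]
    congr 1
    rw [Finset.card_univ, Fintype.card_congr (β := Fin m)
      ⟨fun x => x.1.1, fun a => ⟨(a, r), rfl⟩, fun ⟨⟨a, s⟩, hs⟩ => by subst hs; rfl,
        fun _ => rfl⟩, Fintype.card_fin]
  have hdet : (M.submatrix id σ)ᵀ.det = (-1) ^ (m * k) := by
    rw [htri.det_fintype, Finset.prod_congr rfl fun r _ => hblock r, Fin.prod_univ_succ]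
    simp [Fin.succ_ne_zero, ← pow_mul]
  have hperm := Matrix.det_permute' σ M
  rw [← Matrix.det_transpose (M.submatrix id σ), hdet, hσ] at hperm
  have hsq : ((-1 : ℤ) ^ (m * k.choose 2)) * (-1) ^ (m * k.choose 2) = 1 := by
    rw [← mul_pow]; simp
  -- The k blocks of determinant (-1)^m contribute mk to the exponent, and the sign of σ contributes
  -- m · `k.choose 2`.
  rw [Nat.choose_succ_succ' k 1, Nat.choose_one_right, mul_add, pow_add, hperm]
  push_cast
  linear_combination (-M.det) * hsq

lemma hankelDet_centralSum (n k : ℕ) :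
    hankelDet n (centralSum k) = (Matrix.of fun i j : Fin n => centralFunctional k
      (centralBasis k (i / (k + 1)) (i % (k + 1)) *
        centralBasis k (j / (k + 1)) (j % (k + 1)))).det :=
  hankelDet_eq_det_gram _ _ (centralFunctional_X_pow k) n
    (fun i => centralBasis k (i / (k + 1)) (i % (k + 1)))
    (fun i => by rw [natDegree_centralBasis, Nat.mod_add_div]) (fun i => centralBasis_monic _ _ _)

lemma hankelDet_centralSum_mul (k m : ℕ) :
    hankelDet ((k + 1) * m) (centralSum k) = (-1) ^ (m * (k + 1).choose 2) := by
  have hdiv (a : Fin m) (r : Fin (k + 1)) : (r + (k + 1) * a : ℕ) / (k + 1) = a := by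
    rw [Nat.add_mul_div_left _ _ k.succ_pos, Nat.div_eq_of_lt r.2, zero_add]
  have hmod (a : Fin m) (r : Fin (k + 1)) : (r + (k + 1) * a : ℕ) % (k + 1) = r := by
    rw [Nat.add_mul_mod_self_left, Nat.mod_eq_of_lt r.2]
  rw [mul_comm (k + 1), hankelDet_centralSum, ← Matrix.det_submatrix_equiv_self finProdFinEquiv,
    det_of_antitriangular m k]
  all_goals intros
  all_goals simp only [Matrix.submatrix_apply, Matrix.of_apply, finProdFinEquiv_apply_val, hdiv,
    hmod]
  · rw [Fin.val_zero, centralFunctional_centralBasis_mul_zero_zero]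
    exact if_congr Fin.val_inj rfl rfl
  · exact centralFunctional_centralBasis_mul_of_le _ _ _ _ _ ‹_› ‹_›
  · rw [centralFunctional_centralBasis_mul_of_eq _ _ _ _ _ (by lia) (by lia) ‹_›]
    exact if_congr Fin.val_inj rfl rfl

lemma hankelDet_centralSum_mul_add_one (k m : ℕ) :
    hankelDet ((k + 1) * m + 1) (centralSum k) = (-1) ^ (m * (k + 1).choose 2) := by
  rw [← hankelDet_centralSum_mul, hankelDet_centralSum, hankelDet_centralSum,
    Matrix.det_succ_row _ (Fin.last _), Finset.sum_eq_single (Fin.last _)]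
  · simp only [Matrix.of_apply, Fin.val_last, Nat.mul_mod_right, Nat.mul_div_right _ k.succ_pos,
      centralFunctional_centralBasis_mul_zero_zero, if_true, mul_one]
    rw [← two_mul, pow_mul]
    simp only [even_two, Even.neg_pow, one_pow, one_mul, Fin.succAbove_last]
    rfl
  · intro j _ hj
    have hj' : (j : ℕ) < (k + 1) * m := by
      have : (j : ℕ) ≠ (k + 1) * m := fun h => hj (Fin.ext h)
      lia
    have hlt := Nat.mod_lt j k.succ_pos
    rw [Matrix.of_apply, Fin.val_last, Nat.mul_mod_right, Nat.mul_div_right _ k.succ_pos]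
    rcases Nat.eq_zero_or_pos ((j : ℕ) % (k + 1)) with h | h
    · rw [h, centralFunctional_centralBasis_mul_zero_zero, if_neg]
      · simp
      · exact (Nat.div_lt_of_lt_mul hj').ne'
    · rw [centralFunctional_centralBasis_mul_of_le _ _ _ _ _ (by lia) (by lia)]
      simp
  · simp

lemma hankelDet_centralSum_eq_zero (n k : ℕ) (h0 : ¬ n ≡ 0 [MOD k + 1])
    (h1 : ¬ n ≡ 1 [MOD k + 1]) : hankelDet n (centralSum k) = 0 := by
  have hk : 1 < k + 1 := by
    by_contra h
    obtain rfl : k = 0 := by lia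
    exact h0 (Nat.modEq_one)
  rw [Nat.ModEq, Nat.zero_mod] at h0
  rw [Nat.ModEq, Nat.mod_eq_of_lt hk] at h1
  have hn := Nat.mod_add_div n (k + 1)
  have hlt := Nat.mod_lt n k.succ_pos
  have hdiv : ((k + 1) * (n / (k + 1)) + 1) / (k + 1) = n / (k + 1) := by
    rw [Nat.mul_add_div k.succ_pos, Nat.div_eq_of_lt hk, add_zero]
  have hmod : ((k + 1) * (n / (k + 1)) + 1) % (k + 1) = 1 := by
    rw [Nat.mul_add_mod, Nat.mod_eq_of_lt hk]
  rw [hankelDet_centralSum]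
  -- The row a = n / (k + 1), r = 1 exists because n % (k + 1) ≥ 2. It could be nonzero only in the
  -- column with the same a and s = k, whose index is at least n.
  refine Matrix.det_eq_zero_of_row_eq_zero ⟨(k + 1) * (n / (k + 1)) + 1, by lia⟩ fun j => ?_
  rw [Matrix.of_apply, hdiv, hmod]
  have hjlt := Nat.mod_lt j k.succ_pos
  by_cases hj : (j : ℕ) % (k + 1) = k
  · rw [centralFunctional_centralBasis_mul_of_eq _ _ _ _ _ one_ne_zero (by lia) (by lia), if_neg]
    intro h
    have := Nat.mod_add_div (j : ℕ) (k + 1)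
    rw [← h, hj] at this
    have := j.2
    lia
  · exact centralFunctional_centralBasis_mul_of_le _ _ _ _ _ (by lia) (by lia)

lemma centralSum_zero (m : ℕ) : centralSum 0 m = m.choose ((m + 1) / 2) := by
  simp only [centralSum, binomInt, zero_add, Finset.sum_range_one]
  rw [if_pos (by lia)]
  congr 2

lemma hankelDet_centralSum_zero (n : ℕ) : hankelDet n (centralSum 0) = 1 := by
  simpa using hankelDet_centralSum_mul 0 n

end Determinants

theorem corollary13 :
    (∀ n k : ℕ, 1 ≤ n →
      (∀ n₁ : ℕ, n = (k + 1) * n₁ →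
        hankelDet n (centralSum k) = (-1) ^ (n₁ * (k + 1).choose 2)) ∧
      (∀ n₁ : ℕ, n = (k + 1) * n₁ + 1 →
        hankelDet n (centralSum k) = (-1) ^ (n₁ * (k + 1).choose 2)) ∧
      (¬ n ≡ 0 [MOD k + 1] → ¬ n ≡ 1 [MOD k + 1] →
        hankelDet n (centralSum k) = 0)) ∧
    (∀ n : ℕ, 1 ≤ n →
      hankelDet n (fun m => (m.choose ((m + 1) / 2) : ℤ)) = 1 ∧
      hankelDet n (fun m => (m.choose (m / 2) : ℤ)) = 1) := by
  refine ⟨fun n k _ => ⟨?_, ?_, hankelDet_centralSum_eq_zero n k⟩, fun n _ => ?_⟩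
  · rintro m rfl
    exact hankelDet_centralSum_mul k m
  · rintro m rfl
    exact hankelDet_centralSum_mul_add_one k m
  · have h1 : (fun m : ℕ => (m.choose ((m + 1) / 2) : ℤ)) = centralSum 0 :=
      funext fun m => (centralSum_zero m).symm
    have h2 : (fun m : ℕ => (m.choose (m / 2) : ℤ)) = centralSum 0 := by
      rw [← h1]
      funext m
      rw [Nat.choose_symm_of_eq_add (show m = m / 2 + (m + 1) / 2 by lia)]
    rw [h1, h2]
    exact ⟨hankelDet_centralSum_zero n, hankelDet_centralSum_zero n⟩
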